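/- Let $\mathbb{QU}$ be the rational Urysohn space, i.e. the countable metric space with rational distances (unique up to isometry) such that for every finite $A\subseteq\mathbb{QU}$ and every $g:A\to\mathbb{Q}$ with $g(a)\ge 0$ and $|g(a)-g(b)|\le d(a,b)\le g(a)+g(b)$ for all $a,b\in A$, there is $z\in\mathbb{QU}$ with $d(z,a)=g(a)$ for all $a\in A$. Let $\mathbb{U}$, the Urysohn space, be the completion of $\mathbb{QU}$. Write $\mathrm{Aut}(M)$ for the group of all isometries of a metric space $M$ onto itself; each element of $\mathrm{Aut}(\mathbb{QU})$ extends uniquely to an element of $\mathrm{Aut}(\mathbb{U})$, and $\mathrm{Aut}(\mathbb{QU})$ is thereby regarded as a subgroup of $\mathrm{Aut}(\mathbb{U})$. Then there is a subgroup $F$ of $\mathrm{Aut}(\mathbb{QU})$ such that: (1) $F$ is isomorphic to the free group of countably infinite rank; (2) $F$ acts faithfully and homogeneously on $\mathbb{QU}$, where homogeneously means that every isometry from a finite subset of $\mathbb{QU}$ onto a finite subset of $\mathbb{QU}$ is the restriction of some element of $F$; (3) $F$ is dense in $\mathrm{Aut}(\mathbb{QU})$, both in the permutation group topology (induced by the product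 topology on $\mathbb{QU}^{\mathbb{QU}}$ with $\mathbb{QU}$ discrete) and in the weak topology (induced by the product topology on $\mathbb{QU}^{\mathbb{QU}}$ with the metric topology on $\mathbb{QU}$); (4) $F$ is dense in $\mathrm{Aut}(\mathbb{U})$ in the weak topology, i.e. the topology induced by the product topology on $\mathbb{U}^{\mathbb{U}}$; (5) every non-identity element $f$ of $F$ is unbounded, i.e. there is no constant $k$ with $d(x,f(x))\le k$ for all $x\in\mathbb{QU}$. -/

import Mathlib

/-- `X` is (a copy of) the rational Urysohn space `ℚU`: a countable metric space with rational
distances in which every one-point metric extension with rational distances of a finite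
subset `A` is realised.  With `A = ∅` the last clause says that `X` is non-empty. -/
structure IsRationalUrysohn (X : Type*) [MetricSpace X] : Prop where
  countable : Countable X
  rational_dist : ∀ x y : X, ∃ q : ℚ, dist x y = (q : ℝ)
  extension : ∀ (A : Finset X) (g : X → ℚ),
    (∀ a ∈ A, 0 ≤ g a) →
    (∀ a ∈ A, ∀ b ∈ A,
      |(g a : ℝ) - (g b : ℝ)| ≤ dist a b ∧ dist a b ≤ (g a : ℝ) + (g b : ℝ)) →
    ∃ z : X, ∀ a ∈ A, dist z a = (g a : ℝ)

/-- The group of bounded isometries of `M`, as a subgroup of the full isometry group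
`Aut(M) = (M ≃ᵢ M)`. -/
def BAut (M : Type*) [MetricSpace M] : Subgroup (M ≃ᵢ M) where
  carrier := {g | ∃ k : ℝ, ∀ x : M, dist x (g x) ≤ k}
  one_mem' := ⟨0, fun x => (dist_self x).le⟩
  mul_mem' := by
    rintro g h ⟨k, hk⟩ ⟨l, hl⟩
    exact ⟨l + k, fun x => (dist_triangle x (h x) (g (h x))).trans
      (add_le_add (hl x) (hk (h x)))⟩
  inv_mem' := by
    rintro g ⟨k, hk⟩
    refine ⟨k, fun x => ?_⟩
    have h := hk (g⁻¹ x)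
    rwa [IsometryEquiv.apply_inv_self, dist_comm] at h

/-- The weak topology on `Aut(M)`: the topology induced by the product topology on `M ^ M`
(pointwise convergence in the metric space `M`). -/
abbrev weakTopology (M : Type*) [MetricSpace M] : TopologicalSpace (M ≃ᵢ M) :=
  TopologicalSpace.induced (fun (g : M ≃ᵢ M) (x : M) => g x) inferInstance

/-- The permutation group topology on `Aut(M)`: the topology induced by the product topology on
`M ^ M`, where `M` carries the discrete topology. -/
abbrev permTopology (M : Type*) [MetricSpace M] : TopologicalSpace (M ≃ᵢ M) :=
  TopologicalSpace.induced (fun (g : M ≃ᵢ M) (x : M) => g x)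
    (@Pi.topologicalSpace M (fun _ => M) (fun _ => ⊥))

/-- A subgroup `F` of `Aut(M)` acts homogeneously on `M` if every isometry between finite subsets
of `M` is induced by an element of `F`. -/
def ActsHomogeneously {M : Type*} [MetricSpace M] (F : Subgroup (M ≃ᵢ M)) : Prop :=
  ∀ (A B : Set M), A.Finite → B.Finite → ∀ φ : A ≃ᵢ B, ∃ f ∈ F, ∀ a : A, f (a : M) = (φ a : M)

/-- The embedding of `Aut(X)` into the isometry group of the completion of `X`: an isometry of `X`
is sent to its unique continuous extension. -/
noncomputable def extendIsometry (X : Type*) [MetricSpace X] :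
    (X ≃ᵢ X) →* (UniformSpace.Completion X ≃ᵢ UniformSpace.Completion X) where
  toFun g :=
    { toFun := UniformSpace.Completion.map g
      invFun := UniformSpace.Completion.map g.symm
      left_inv := fun x => by
        have h := UniformSpace.Completion.map_comp g.symm.isometry.uniformContinuous
          g.isometry.uniformContinuous
        rw [g.symm_comp_self, UniformSpace.Completion.map_id] at h
        exact congrFun h x
      right_inv := fun x => by
        have h := UniformSpace.Completion.map_comp g.isometry.uniformContinuous
          g.symm.isometry.uniformContinuous
        rw [g.self_comp_symm, UniformSpace.Completion.map_id] at h
        exact congrFun h x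
      isometry_toFun := g.isometry.completion_map }
  map_one' := IsometryEquiv.ext fun x => congrFun UniformSpace.Completion.map_id x
  map_mul' g h := IsometryEquiv.ext fun x =>
    (congrFun (UniformSpace.Completion.map_comp g.isometry.uniformContinuous
      h.isometry.uniformContinuous) x).symm

theorem extendIsometry_coe {X : Type*} [MetricSpace X] (g : X ≃ᵢ X) (x : X) :
    extendIsometry X g (x : UniformSpace.Completion X) = (g x : X) :=
  UniformSpace.Completion.map_coe g.isometry.uniformContinuous x

/-! A rational Urysohn space exists: its points are added one at a time, as the points of a
pseudometric on `ℕ`, and points at distance zero are then identified. -/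

namespace RationalUrysohn

/-- A rational pseudometric on `ℕ`. -/
structure PM where
  d : ℕ → ℕ → ℚ
  self : ∀ i, d i i = 0
  comm : ∀ i j, d i j = d j i
  tri : ∀ i j k, d i k ≤ d i j + d j k

/-- The functions which are distances to a point of a one-point extension. -/
def Kat (D : PM) (k : ℕ → ℚ) : Prop := ∀ x y, k x ≤ D.d x y + k y ∧ D.d x y ≤ k x + k y

theorem Kat.nonneg {D : PM} {k : ℕ → ℚ} (h : Kat D k) (x : ℕ) : 0 ≤ k x := by
  have := (h x x).2
  rw [D.self] at this
  linarith

theorem PM.kat (D : PM) (z : ℕ) : Kat D (D.d z) := fun x y =>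
  ⟨by linarith [D.tri z y x, D.comm x y], by linarith [D.tri x z y, D.comm x z]⟩

/-- Replace the point `n` by a point with distances `k` to all others. -/
def step (D : PM) (n : ℕ) (k : ℕ → ℚ) (h : Kat D k) : PM where
  d i j := if i = n then (if j = n then 0 else k j) else (if j = n then k i else D.d i j)
  self i := by by_cases hi : i = n <;> simp [hi, D.self]
  comm i j := by
    by_cases hi : i = n <;> by_cases hj : j = n <;> simp [hi, hj, D.comm i j]
  tri i j l := by
    have h0 := h.nonneg
    by_cases hi : i = n <;> by_cases hj : j = n <;> by_cases hl : l = n <;>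
      simp only [hi, hj, hl, if_true, if_false]
    · simp
    · simp
    · linarith [h0 j]
    · linarith [(h l j).1, D.comm l j]
    · simp
    · exact (h i l).2
    · exact (h i j).1
    · exact D.tri i j l

theorem exists_kat (D : PM) (A : Finset ℕ) (g : ℕ → ℚ)
    (hg : ∀ a ∈ A, ∀ b ∈ A, g a ≤ D.d a b + g b ∧ D.d a b ≤ g a + g b) :
    ∃ k, Kat D k ∧ ∀ a ∈ A, k a = g a := by
  rcases A.eq_empty_or_nonempty with rfl | hA
  · exact ⟨_, D.kat 0, by simp⟩
  have key : ∀ x, ∃ a ∈ A, A.inf' hA (fun a => D.d x a + g a) = D.d x a + g a := fun x =>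
    A.exists_mem_eq_inf' hA _
  have le : ∀ x, ∀ a ∈ A, A.inf' hA (fun a => D.d x a + g a) ≤ D.d x a + g a := fun x a ha =>
    A.inf'_le _ ha
  refine ⟨fun x => A.inf' hA (fun a => D.d x a + g a), fun x y => ⟨?_, ?_⟩, fun a ha => ?_⟩
  · obtain ⟨b, hb, e⟩ := key y
    simp only [e]
    linarith [le x b hb, D.tri x y b]
  · obtain ⟨a, ha, e⟩ := key x
    obtain ⟨b, hb, e'⟩ := key y
    simp only [e, e']
    linarith [(hg a ha b hb).2, D.tri x a y, D.tri a b y, D.comm b y]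
  · obtain ⟨b, hb, e⟩ := key a
    have h1 := le a a ha
    rw [D.self] at h1
    simp only [e] at h1 ⊢
    linarith [(hg a ha b hb).1]

open Classical in
/-- Distances to the new point, subject to a list of prescribed values if these are consistent. -/
noncomputable def newDist (D : PM) (L : List (ℕ × ℚ)) : {k : ℕ → ℚ // Kat D k} :=
  if h : ∃ k, Kat D k ∧ ∀ p ∈ L, k p.1 = p.2 then ⟨h.choose, h.choose_spec.1⟩
  else ⟨D.d 0, D.kat 0⟩

theorem newDist_eq (D : PM) (L : List (ℕ × ℚ)) (h : ∃ k, Kat D k ∧ ∀ p ∈ L, k p.1 = p.2) :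
    ∀ p ∈ L, (newDist D L).1 p.1 = p.2 := by
  rw [newDist, dif_pos h]
  exact h.choose_spec.2

/-- An enumeration of all lists of prescribed values, each occurring infinitely often. -/
def task (n : ℕ) : List (ℕ × ℚ) := Denumerable.ofNat (List (ℕ × ℚ)) n.unpair.1

theorem exists_task (L : List (ℕ × ℚ)) (N : ℕ) : ∃ n, N ≤ n ∧ task n = L := by
  obtain ⟨e, he⟩ := (Denumerable.eqv (List (ℕ × ℚ))).symm.surjective L
  refine ⟨Nat.pair e N, Nat.right_le_pair _ _, ?_⟩
  simp only [task, Nat.unpair_pair]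
  exact he

noncomputable def approx : ℕ → PM
  | 0 => ⟨fun _ _ => 0, fun _ => rfl, fun _ _ => rfl, fun _ _ _ => by simp⟩
  | n + 1 => step (approx n) n (newDist (approx n) (task n)).1 (newDist (approx n) (task n)).2

theorem approx_stable {i j m n : ℕ} (hi : i < m) (hj : j < m) (h : m ≤ n) :
    (approx n).d i j = (approx m).d i j := by
  induction n, h using Nat.le_induction with
  | base => rfl
  | succ n hn ih =>
    rw [← ih, approx]
    simp only [step]
    rw [if_neg (by omega), if_neg (by omega)]

noncomputable def lim (i j : ℕ) : ℚ := (approx (i + j + 1)).d i j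

theorem lim_eq {i j m : ℕ} (hi : i < m) (hj : j < m) : lim i j = (approx m).d i j := by
  rw [lim, ← approx_stable (m := i + j + 1) (n := i + j + 1 + m) (by omega) (by omega) (by omega),
    ← approx_stable (m := m) (n := i + j + 1 + m) hi hj (by omega)]

theorem lim_extension (A : Finset ℕ) (g : ℕ → ℚ)
    (hg : ∀ a ∈ A, ∀ b ∈ A, g a ≤ lim a b + g b ∧ lim a b ≤ g a + g b) :
    ∃ z, ∀ a ∈ A, lim z a = g a := by
  obtain ⟨n, hn, ht⟩ := exists_task (A.toList.map fun a => (a, g a)) (A.sup id + 1)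
  have hlt : ∀ a ∈ A, a < n := fun a ha => by
    have : a ≤ A.sup id := Finset.le_sup (f := id) ha
    omega
  obtain ⟨k, hk, hkg⟩ := exists_kat (approx n) A g fun a ha b hb => by
    rw [← lim_eq (hlt a ha) (hlt b hb)]
    exact hg a ha b hb
  refine ⟨n, fun a ha => ?_⟩
  have hne : a ≠ n := (hlt a ha).ne
  rw [lim_eq (m := n + 1) (by omega) (by linarith [hlt a ha]), approx]
  simp only [step]
  rw [if_pos trivial, if_neg hne]
  refine newDist_eq (approx n) (task n) ⟨k, hk, ?_⟩ (a, g a) ?_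
  · rw [ht]
    simpa using hkg
  · rw [ht]
    simpa using ha

/-- The points of the pseudometric. -/
def Pre : Type := ℕ

noncomputable instance : PseudoMetricSpace Pre where
  dist i j := (lim i j : ℝ)
  dist_self (i : ℕ) := by
    rw [lim, PM.self, Rat.cast_zero]
  dist_comm (i j : ℕ) := by
    rw [lim, PM.comm, lim, Nat.add_comm i j]
  dist_triangle (i j k : ℕ) := by
    rw [lim_eq (m := i + j + k + 1) (i := i) (j := k) (by omega) (by omega),
      lim_eq (m := i + j + k + 1) (i := i) (j := j) (by omega) (by omega),
      lim_eq (m := i + j + k + 1) (i := j) (j := k) (by omega) (by omega)]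
    exact_mod_cast PM.tri _ i j k

theorem pre_dist (i j : ℕ) : dist (α := Pre) i j = (lim i j : ℝ) := rfl

end RationalUrysohn

/-- The rational Urysohn space exists. -/
theorem exists_isRationalUrysohn :
    ∃ (X : Type) (_ : MetricSpace X), IsRationalUrysohn X := by
  classical
  refine ⟨SeparationQuotient RationalUrysohn.Pre, inferInstance, ?_, ?_, ?_⟩
  · have : Countable RationalUrysohn.Pre := inferInstanceAs (Countable ℕ)
    exact SeparationQuotient.surjective_mk.countable
  · intro x y
    obtain ⟨i, rfl⟩ := SeparationQuotient.surjective_mk x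
    obtain ⟨j, rfl⟩ := SeparationQuotient.surjective_mk y
    exact ⟨RationalUrysohn.lim i j, rfl⟩
  · intro A g _ hg
    obtain ⟨s, hs⟩ : ∃ s : SeparationQuotient RationalUrysohn.Pre → ℕ,
        ∀ x, SeparationQuotient.mk (X := RationalUrysohn.Pre) (s x) = x :=
      ⟨_, fun x => (SeparationQuotient.surjective_mk x).choose_spec⟩
    have hd : ∀ x y, dist x y = (RationalUrysohn.lim (s x) (s y) : ℝ) := fun x y => by
      conv_lhs => rw [← hs x, ← hs y]
      rfl
    obtain ⟨z, hz⟩ := RationalUrysohn.lim_extension (A.image s)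
      (fun i => g (SeparationQuotient.mk (X := RationalUrysohn.Pre) i)) (by
        intro a ha b hb
        obtain ⟨x, hx, rfl⟩ := Finset.mem_image.1 ha
        obtain ⟨y, hy, rfl⟩ := Finset.mem_image.1 hb
        simp only [hs]
        have h := hg x hx y hy
        rw [hd, abs_le] at h
        have h1 : (g x : ℝ) ≤ (RationalUrysohn.lim (s x) (s y) : ℝ) + (g y : ℝ) := by
          linarith [h.1.2]
        exact ⟨by exact_mod_cast h1, by exact_mod_cast h.2⟩)
    refine ⟨SeparationQuotient.mk (X := RationalUrysohn.Pre) z, fun a ha => ?_⟩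
    have h := hz (s a) (Finset.mem_image_of_mem s ha)
    simp only [hs] at h
    rw [← h]
    conv_lhs => rw [← hs a]
    rfl

/-!
The subgroup `F` is generated by a sequence `f` of isometries of `X` that is generic for finite
approximations (`PartialSeq`): finite sets of statements "`f n` sends `x` to `y`" which for every
`n` describe an isometry between finite subsets of `X`. By the Rasiowa–Sikorski lemma it suffices
that each of the following countably many requirements can be met by enlarging any given
approximation.

* `f n` and its inverse are defined at `x`: this is the extension property of `X`.
* A given finite partial isometry is contained in some `f n`: take an index `n` not yet used.
* A given nonempty reduced word `w` moves some point by at least `K`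
  (`PartialSeq.exists_le_path`). Start from a point at distance at least `K` from all points in use
  and apply the letters of `w` one after the other. As `w` is reduced, the next letter is undefined
  at the current end point of the path, and is defined only at points at distance at least `K` from
  it. The image of the end point can be chosen by amalgamating over the range of the letter, and is
  then at distance at least `K` from all points in use, among them the start of the path
  (`IsRationalUrysohn.exists_extension_far`).

The last requirement makes every nontrivial word in `f` unbounded, so `F` is free on `f`. The second
one is homogeneity, which gives density in `Aut(X)` for every topology of pointwise convergence.
Density in the isometry group of the completion follows because an isometry of the completion is
approximated on finite sets by finite partial isometries of `X` (`IsRationalUrysohn.exists_approx`).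
That is shown one point at a time: a point of `X` with almost the right distances to a finite set
has near it a point with exactly the right distances (`IsRationalUrysohn.exists_extension_near`).
-/

/-! ### One-point extensions -/

namespace IsRationalUrysohn

variable {X : Type*} [MetricSpace X]

/-- The extension property for a real-valued distance function with rational values on `A`.
Nonnegativity follows from the triangle inequalities. -/
theorem exists_dist_eq (hX : IsRationalUrysohn X) (A : Finset X) (g : X → ℝ)
    (hq : ∀ a ∈ A, ∃ q : ℚ, g a = q)
    (hg : ∀ a ∈ A, ∀ b ∈ A, g a - g b ≤ dist a b ∧ dist a b ≤ g a + g b) :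
    ∃ z : X, ∀ a ∈ A, dist z a = g a := by
  classical
  choose! q hq using hq
  obtain ⟨z, hz⟩ := hX.extension A q
    (fun a ha => by
      have h := (hg a ha a ha).2
      rw [dist_self, hq a ha] at h
      have : (0 : ℝ) ≤ q a := by linarith
      exact_mod_cast this)
    (fun a ha b hb => by
      rw [← hq a ha, ← hq b hb, abs_le]
      have h := (hg b hb a ha).1
      rw [dist_comm] at h
      exact ⟨⟨by linarith, (hg a ha b hb).1⟩, (hg a ha b hb).2⟩)
  exact ⟨z, fun a ha => (hz a ha).trans (hq a ha).symm⟩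

theorem nonempty (hX : IsRationalUrysohn X) : Nonempty X :=
  let ⟨z, _⟩ := hX.extension ∅ 0 (by simp) (by simp)
  ⟨z⟩

theorem exists_dist_eq_natCast (hX : IsRationalUrysohn X) (x : X) (K : ℕ) :
    ∃ z : X, dist z x = K := by
  obtain ⟨z, hz⟩ := hX.exists_dist_eq {x} (fun _ => K) (fun _ _ => ⟨K, by simp⟩)
    (by simp)
  exact ⟨z, hz x (by simp)⟩

end IsRationalUrysohn

/-- A finite set of pairs is the graph of an isometry between finite subsets of `X`. -/
def IsPartialIsometry {X : Type*} [MetricSpace X] (S : Finset (X × X)) : Prop :=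
  ∀ p ∈ S, ∀ q ∈ S, dist p.1 q.1 = dist p.2 q.2

namespace IsRationalUrysohn

variable {X : Type*} [MetricSpace X]

/-- A finite partial isometry extends to any further point `x`, and the image of `x` can be kept as
far from a finite set as `x` is from the domain. -/
theorem exists_extension_far (hX : IsRationalUrysohn X) {S : Finset (X × X)}
    (hS : IsPartialIsometry S) (x : X) (K : ℕ) (hK : ∀ p ∈ S, (K : ℝ) ≤ dist x p.1)
    (T : Finset X) :
    ∃ y : X, (∀ p ∈ S, dist y p.2 = dist x p.1) ∧ ∀ t ∈ T, (K : ℝ) ≤ dist y t := by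
  classical
  -- An empty domain is replaced by one point at distance `K` from `x`.
  wlog hne : S.Nonempty generalizing S
  · obtain ⟨a, ha⟩ := hX.exists_dist_eq_natCast x K
    obtain ⟨y, -, hy⟩ := this (S := {(a, x)}) (by simp [IsPartialIsometry])
      (by simp [dist_comm x a, ha]) (by simp)
    rw [Finset.not_nonempty_iff_eq_empty] at hne
    exact ⟨y, by simp [hne], hy⟩
  -- The largest possible distances: those of the metric amalgam over the range of `S`.
  let g : X → ℝ := fun t => S.inf' hne fun p => dist x p.1 + dist p.2 t
  have key : ∀ t, ∃ p ∈ S, g t = dist x p.1 + dist p.2 t := fun t => S.exists_mem_eq_inf' hne _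
  have le : ∀ t, ∀ p ∈ S, g t ≤ dist x p.1 + dist p.2 t := fun t p hp => S.inf'_le _ hp
  obtain ⟨y, hy⟩ := hX.exists_dist_eq (S.image Prod.snd ∪ T) g
    (fun t _ => by
      obtain ⟨p, -, hp⟩ := key t
      obtain ⟨q, hq⟩ := hX.rational_dist x p.1
      obtain ⟨r, hr⟩ := hX.rational_dist p.2 t
      exact ⟨q + r, by rw [hp, hq, hr, Rat.cast_add]⟩)
    (fun s _ t _ => by
      obtain ⟨p, hp, hpt⟩ := key t
      obtain ⟨q, hq, hqs⟩ := key s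
      constructor
      · have := le s p hp
        have := dist_triangle p.2 t s
        rw [dist_comm t s] at this
        linarith
      · have h1 := dist_triangle4 s q.2 p.2 t
        have h2 := dist_triangle_left q.1 p.1 x
        rw [hS q hq p hp] at h2
        rw [dist_comm s q.2] at h1
        linarith)
  refine ⟨y, fun p hp => ?_, fun t ht => ?_⟩
  · rw [hy _ (Finset.mem_union_left _ (Finset.mem_image_of_mem _ hp))]
    refine le_antisymm (by simpa using le p.2 p hp) ?_
    obtain ⟨q, hq, h⟩ := key p.2
    rw [h, ← hS q hq p hp]
    exact dist_triangle _ _ _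
  · rw [hy t (Finset.mem_union_right _ ht)]
    obtain ⟨q, hq, h⟩ := key t
    rw [h]
    exact (hK q hq).trans (le_add_of_nonneg_right dist_nonneg)

/-- If `z` almost has the distances required of the image of `x` under an extension of the partial
isometry `S`, then a point near `z` has exactly these distances. -/
theorem exists_extension_near (hX : IsRationalUrysohn X) {S : Finset (X × X)}
    (hS : IsPartialIsometry S) (x z : X) {η : ℝ} (hη : 0 ≤ η)
    (hz : ∀ p ∈ S, |dist x p.1 - dist p.2 z| ≤ η) :
    ∃ y : X, (∀ p ∈ S, dist y p.2 = dist x p.1) ∧ dist y z ≤ η := by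
  classical
  rcases S.eq_empty_or_nonempty with rfl | hne
  · exact ⟨z, by simp, by simpa using hη⟩
  -- The smallest possible distances.
  let g : X → ℝ := fun t => S.sup' hne fun p => |dist x p.1 - dist p.2 t|
  have key : ∀ t, ∃ p ∈ S, g t = |dist x p.1 - dist p.2 t| := fun t => S.exists_mem_eq_sup' hne _
  have le : ∀ t, ∀ p ∈ S, |dist x p.1 - dist p.2 t| ≤ g t := fun t p hp =>
    S.le_sup' (fun p => |dist x p.1 - dist p.2 t|) hp
  have hgS : ∀ p ∈ S, g p.2 = dist x p.1 := fun p hp => by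
    refine le_antisymm ?_ (by simpa using le p.2 p hp)
    obtain ⟨q, hq, h⟩ := key p.2
    rw [h, ← hS q hq p hp, dist_comm q.1]
    exact abs_dist_sub_le x p.1 q.1
  have add : ∀ p ∈ S, ∀ t, dist p.2 t ≤ g p.2 + g t := fun p hp t => by
    have := (abs_le.1 (le t p hp)).1
    rw [hgS p hp]
    linarith
  obtain ⟨y, hy⟩ := hX.exists_dist_eq (insert z (S.image Prod.snd)) g
    (fun t _ => by
      obtain ⟨p, -, hp⟩ := key t
      obtain ⟨q, hq⟩ := hX.rational_dist x p.1
      obtain ⟨r, hr⟩ := hX.rational_dist p.2 t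
      exact ⟨|q - r|, by rw [hp, hq, hr, Rat.cast_abs, Rat.cast_sub]⟩)
    (fun s hs t ht => by
      constructor
      · obtain ⟨p, hp, h⟩ := key s
        have h1 := le t p hp
        have h2 := abs_dist_sub_le s t p.2
        rw [dist_comm s p.2, dist_comm t p.2] at h2
        rw [abs_le] at h1 h2
        rw [h, sub_le_iff_le_add, abs_le]
        constructor <;> linarith
      · rcases Finset.mem_insert.1 hs with rfl | hs
        · rcases Finset.mem_insert.1 ht with rfl | ht
          · obtain ⟨p, hp, h⟩ := key t
            rw [dist_self, h]
            positivity
          · obtain ⟨p, hp, rfl⟩ := Finset.mem_image.1 ht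
            rw [dist_comm, add_comm]
            exact add p hp _
        · obtain ⟨p, hp, rfl⟩ := Finset.mem_image.1 hs
          exact add p hp t)
  refine ⟨y, fun p hp => ?_, ?_⟩
  · rw [hy _ (Finset.mem_insert_of_mem (Finset.mem_image_of_mem _ hp)), hgS p hp]
  · rw [hy z (Finset.mem_insert_self _ _)]
    exact Finset.sup'_le _ _ hz

end IsRationalUrysohn

/-! ### Finite approximations to a sequence of isometries -/

/-- A finite approximation to a sequence of isometries of `X`: finitely many triples `(n, x, y)`,
each saying that the `n`-th isometry sends `x` to `y`, such that for every `n` the pairs `(x, y)`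
form a partial isometry. Approximations are ordered by inclusion. -/
def PartialSeq (X : Type*) [MetricSpace X] : Type _ :=
  {p : Finset (ℕ × X × X) // ∀ n x y x' y', (n, x, y) ∈ p → (n, x', y') ∈ p →
    dist x x' = dist y y'}

namespace PartialSeq

variable {X : Type*} [MetricSpace X]

instance : PartialOrder (PartialSeq X) := inferInstanceAs (PartialOrder (Subtype _))

/-- The triple saying that the letter `l` sends `x` to `y`, where `(n, true)` stands for the `n`-th
isometry and `(n, false)` for its inverse, as in Mathlib's free group. -/
def triple (l : ℕ × Bool) (x y : X) : ℕ × X × X := (l.1, bif l.2 then (x, y) else (y, x))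

/-- The approximation `p` decides that the letter `l` sends `x` to `y`. -/
def Sends (p : PartialSeq X) (l : ℕ × Bool) (x y : X) : Prop := triple l x y ∈ p.1

/-- The approximation `p` decides that the word `L`, read as a product of letters and hence applied
from right to left, sends `x` to `y`. -/
def WordSends (p : PartialSeq X) : List (ℕ × Bool) → X → X → Prop
  | [], x, y => x = y
  | l :: L, x, y => ∃ z, p.WordSends L x z ∧ p.Sends l z y

theorem Sends.mono {p q : PartialSeq X} (h : p ≤ q) {l : ℕ × Bool} {x y : X}
    (hp : p.Sends l x y) : q.Sends l x y :=
  h hp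

theorem WordSends.mono {p q : PartialSeq X} (h : p ≤ q) {L : List (ℕ × Bool)} {x y : X}
    (hp : p.WordSends L x y) : q.WordSends L x y := by
  induction L generalizing y with
  | nil => exact hp
  | cons l L ih =>
    obtain ⟨z, hz, hl⟩ := hp
    exact ⟨z, ih hz, hl.mono h⟩

theorem Sends.dist_eq {p : PartialSeq X} {l : ℕ × Bool} {x y x' y' : X}
    (h : p.Sends l x y) (h' : p.Sends l x' y') : dist x x' = dist y y' := by
  obtain ⟨n, b⟩ := l
  cases b
  · exact (p.2 n _ _ _ _ h h').symm
  · exact p.2 n _ _ _ _ h h'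

open Classical in
/-- The graph of the letter `l` in the approximation `p`. -/
noncomputable def graph (p : PartialSeq X) (l : ℕ × Bool) : Finset (X × X) :=
  (p.1.image fun t => bif l.2 then t.2 else t.2.swap).filter fun s => p.Sends l s.1 s.2

theorem mem_graph {p : PartialSeq X} {l : ℕ × Bool} {s : X × X} :
    s ∈ p.graph l ↔ p.Sends l s.1 s.2 := by
  obtain ⟨n, b⟩ := l
  simp only [graph, Finset.mem_filter, Finset.mem_image, and_iff_right_iff_imp]
  exact fun h => ⟨_, h, by cases b <;> rfl⟩

theorem isPartialIsometry_graph (p : PartialSeq X) (l : ℕ × Bool) :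
    IsPartialIsometry (p.graph l) := fun _ hs _ ht =>
  (mem_graph.1 hs).dist_eq (mem_graph.1 ht)

open Classical in
/-- The points occurring in an approximation. -/
noncomputable def support (p : PartialSeq X) : Finset X :=
  p.1.image (fun t => t.2.1) ∪ p.1.image (fun t => t.2.2)

theorem Sends.mem_support {p : PartialSeq X} {l : ℕ × Bool} {x y : X} (h : p.Sends l x y) :
    x ∈ p.support ∧ y ∈ p.support := by
  obtain ⟨n, b⟩ := l
  simp only [support, Finset.mem_union, Finset.mem_image]
  cases b
  · exact ⟨Or.inr ⟨_, h, rfl⟩, Or.inl ⟨_, h, rfl⟩⟩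
  · exact ⟨Or.inl ⟨_, h, rfl⟩, Or.inr ⟨_, h, rfl⟩⟩

open Classical in
/-- Let the letter `l` send the further point `x` to `y`. -/
noncomputable def extend (p : PartialSeq X) (l : ℕ × Bool) (x y : X)
    (h : ∀ s ∈ p.graph l, dist y s.2 = dist x s.1) : PartialSeq X :=
  ⟨insert (triple l x y) p.1, by
    obtain ⟨m, b⟩ := l
    simp only [mem_graph, Prod.forall] at h
    simp only [Finset.mem_insert]
    intro n u v u' v' h1 h2
    cases b
    · simp only [triple, cond_false, Prod.mk.injEq] at h1 h2
      rcases h1 with ⟨rfl, rfl, rfl⟩ | h1 <;> rcases h2 with ⟨h2, rfl, rfl⟩ | h2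
      · simp
      · exact h _ _ h2
      · subst h2
        rw [dist_comm, dist_comm v]
        exact h _ _ h1
      · exact p.2 _ _ _ _ _ h1 h2
    · simp only [triple, cond_true, Prod.mk.injEq] at h1 h2
      rcases h1 with ⟨rfl, rfl, rfl⟩ | h1 <;> rcases h2 with ⟨h2, rfl, rfl⟩ | h2
      · simp
      · exact (h _ _ h2).symm
      · subst h2
        rw [dist_comm, dist_comm v]
        exact (h _ _ h1).symm
      · exact p.2 _ _ _ _ _ h1 h2⟩

theorem le_extend (p : PartialSeq X) (l : ℕ × Bool) (x y : X)
    (h : ∀ s ∈ p.graph l, dist y s.2 = dist x s.1) : p ≤ p.extend l x y h := by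
  classical
  exact Finset.subset_insert (triple l x y) p.1

theorem sends_extend (p : PartialSeq X) (l : ℕ × Bool) (x y : X)
    (h : ∀ s ∈ p.graph l, dist y s.2 = dist x s.1) : (p.extend l x y h).Sends l x y := by
  classical
  exact Finset.mem_insert_self (triple l x y) p.1

theorem Sends.of_extend {p : PartialSeq X} {l : ℕ × Bool} {x y : X}
    {h : ∀ s ∈ p.graph l, dist y s.2 = dist x s.1} {l' : ℕ × Bool} {u v : X}
    (hs : (p.extend l x y h).Sends l' u v) :
    p.Sends l' u v ∨ (l' = l ∧ u = x) ∨ (l'.1 = l.1 ∧ l'.2 ≠ l.2) := by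
  classical
  obtain ⟨n, b⟩ := l
  obtain ⟨n', b'⟩ := l'
  rcases Finset.mem_insert.1 hs with h | h
  · cases b <;> cases b' <;> simp_all [triple]
  · exact Or.inl h

/-! ### Enlarging finite approximations -/

theorem exists_le_sends (hX : IsRationalUrysohn X) (p : PartialSeq X) (l : ℕ × Bool) (x : X) :
    ∃ q, p ≤ q ∧ ∃ y, q.Sends l x y := by
  obtain ⟨y, hy, -⟩ := hX.exists_extension_far (p.isPartialIsometry_graph l) x 0
    (fun _ _ => by simp) ∅
  exact ⟨p.extend l x y hy, p.le_extend l x y hy, y, p.sends_extend l x y hy⟩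

theorem exists_le_forall_sends (p : PartialSeq X) {S : Finset (X × X)}
    (hS : IsPartialIsometry S) : ∃ q, p ≤ q ∧ ∃ n, ∀ s ∈ S, q.Sends (n, true) s.1 s.2 := by
  classical
  obtain ⟨n, hn⟩ := Infinite.exists_notMem_finset (p.1.image Prod.fst)
  have hn' : ∀ s, (n, s) ∉ p.1 := fun s h => hn (Finset.mem_image_of_mem Prod.fst h)
  refine ⟨⟨p.1 ∪ S.image fun s => (n, s), ?_⟩, Finset.subset_union_left, n, fun s hs =>
    Finset.mem_union_right _ (Finset.mem_image_of_mem _ hs)⟩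
  intro m x y x' y' h h'
  simp only [Finset.mem_union, Finset.mem_image, Prod.mk.injEq] at h h'
  rcases h with h | ⟨s, hs, rfl, rfl⟩ <;> rcases h' with h' | ⟨t, ht, h', rfl⟩
  · exact p.2 _ _ _ _ _ h h'
  · subst h'
    exact absurd h (hn' _)
  · exact absurd h' (hn' _)
  · exact hS _ hs _ ht

/-- Along a reduced word `L`, the path of a point far from the support can be continued so that it
always stays far from all earlier points. The last clause is what the next letter `l` needs: as `l`
does not cancel against `L`, it is undefined near the end point `y` of the path. -/
theorem exists_le_path (hX : IsRationalUrysohn X) (p : PartialSeq X) (K : ℕ)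
    (L : List (ℕ × Bool)) (hL : FreeGroup.IsReduced L) :
    ∃ q, p ≤ q ∧ ∃ x y, q.WordSends L x y ∧ (L ≠ [] → (K : ℝ) ≤ dist x y) ∧
      ∀ l, FreeGroup.IsReduced (l :: L) → ∀ s ∈ q.graph l, (K : ℝ) ≤ dist y s.1 := by
  classical
  induction L with
  | nil =>
    obtain ⟨x₀⟩ := hX.nonempty
    obtain ⟨y, -, hy⟩ := hX.exists_extension_far (S := ∅) (by simp [IsPartialIsometry]) x₀ K
      (by simp) p.support
    exact ⟨p, le_rfl, y, y, rfl, by simp, fun l _ s hs =>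
      hy _ (mem_graph.1 hs).mem_support.1⟩
  | cons l L ih =>
    obtain ⟨q, hpq, x, y, hw, -, hfar⟩ := ih (hL.infix (List.suffix_cons l L).isInfix)
    obtain ⟨z, hz, hzT⟩ := hX.exists_extension_far (q.isPartialIsometry_graph l) y K
      (hfar l hL) (insert x (insert y q.support))
    refine ⟨q.extend l y z hz, hpq.trans (q.le_extend l y z hz), x, z,
      ⟨y, hw.mono (q.le_extend l y z hz), q.sends_extend l y z hz⟩, fun _ => ?_,
      fun l' hl' s hs => ?_⟩
    · rw [dist_comm]
      exact hzT x (by simp)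
    · rcases (mem_graph.1 hs).of_extend with h | ⟨-, h⟩ | ⟨h1, h2⟩
      · exact hzT _ (by simp [h.mem_support.1])
      · exact hzT _ (by simp [h])
      · exact absurd ((FreeGroup.isReduced_cons_cons.1 hl').1 h1) h2

end PartialSeq

/-! ### A generic sequence of isometries -/

/-- There is a sequence of isometries in which every finite partial isometry has an extension, and
along which every nonempty reduced word moves some points arbitrarily far. -/
theorem IsRationalUrysohn.exists_generic_seq {X : Type*} [MetricSpace X]
    (hX : IsRationalUrysohn X) :
    ∃ f : ℕ → X ≃ᵢ X,
      (∀ S : Finset (X × X), IsPartialIsometry S → ∃ n, ∀ s ∈ S, f n s.1 = s.2) ∧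
      ∀ L : List (ℕ × Bool), FreeGroup.IsReduced L → L ≠ [] → ∀ K : ℕ,
        ∃ x, (K : ℝ) ≤ dist x (FreeGroup.lift f (FreeGroup.mk L) x) := by
  classical
  have := hX.countable
  let ι := ((ℕ × Bool) × X) ⊕ {S : Finset (X × X) // IsPartialIsometry S} ⊕
    ({L : List (ℕ × Bool) // FreeGroup.IsReduced L ∧ L ≠ []} × ℕ)
  let _ : Encodable ι := Encodable.ofCountable ι
  let D : ι → Order.Cofinal (PartialSeq X)
    | .inl t => ⟨{q | ∃ y, q.Sends t.1 t.2 y}, fun p => by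
        obtain ⟨q, h, hq⟩ := p.exists_le_sends hX t.1 t.2
        exact ⟨q, hq, h⟩⟩
    | .inr (.inl S) => ⟨{q | ∃ n, ∀ s ∈ S.1, q.Sends (n, true) s.1 s.2}, fun p => by
        obtain ⟨q, h, hq⟩ := p.exists_le_forall_sends S.2
        exact ⟨q, hq, h⟩⟩
    | .inr (.inr t) => ⟨{q | ∃ x y, q.WordSends t.1.1 x y ∧ (t.2 : ℝ) ≤ dist x y}, fun p => by
        obtain ⟨q, h, x, y, hw, hd, -⟩ := p.exists_le_path hX t.2 t.1.1 t.1.2.1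
        exact ⟨q, ⟨x, y, hw, hd t.1.2.2⟩, h⟩⟩
  let I : Order.Ideal (PartialSeq X) := Order.idealOfCofinals (P := PartialSeq X) ⟨∅, by simp⟩ D
  have meets : ∀ i, ∃ p, p ∈ D i ∧ p ∈ I := Order.cofinal_meets_idealOfCofinals _ D
  have total : ∀ l x, ∃ y, ∃ p : PartialSeq X, p ∈ I ∧ p.Sends l x y := fun l x => by
    obtain ⟨p, ⟨y, hy⟩, hp⟩ := meets (.inl (l, x))
    exact ⟨y, p, hp, hy⟩
  choose F P hP hF using total
  have dist_eq : ∀ {l x y x' y'} {p q : PartialSeq X}, p ∈ I → q ∈ I → p.Sends l x y →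
      q.Sends l x' y' → dist x x' = dist y y' := fun hp hq h h' => by
    obtain ⟨r, -, hpr, hqr⟩ := I.directed _ hp _ hq
    exact (h.mono hpr).dist_eq (h'.mono hqr)
  have F_eq : ∀ {l x y} {p : PartialSeq X}, p ∈ I → p.Sends l x y → F l x = y := fun hp h => by
    rw [← dist_eq_zero, ← dist_eq (hP _ _) hp (hF _ _) h, dist_self]
  let f : ℕ → X ≃ᵢ X := fun n =>
    { toFun := F (n, true)
      invFun := F (n, false)
      left_inv := fun x => F_eq (hP _ _) (hF (n, true) x)
      right_inv := fun x => F_eq (hP _ _) (hF (n, false) x)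
      isometry_toFun := Isometry.of_dist_eq fun x y =>
        (dist_eq (hP _ _) (hP _ _) (hF _ x) (hF _ y)).symm }
  have word : ∀ {p : PartialSeq X}, p ∈ I → ∀ {L x y}, p.WordSends L x y →
      FreeGroup.lift f (FreeGroup.mk L) x = y := fun hp L => by
    induction L with
    | nil => exact fun h => h
    | cons l L ih =>
      rintro x y ⟨z, hz, hl⟩
      rw [FreeGroup.lift_mk, List.map_cons, List.prod_cons, IsometryEquiv.mul_apply,
        ← FreeGroup.lift_mk, ih hz]
      obtain ⟨n, b⟩ := l
      cases b
      · exact F_eq hp hl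
      · exact F_eq hp hl
  refine ⟨f, fun S hS => ?_, fun L hL hne K => ?_⟩
  · obtain ⟨p, ⟨n, hn⟩, hp⟩ := meets (.inr (.inl ⟨S, hS⟩))
    exact ⟨n, fun s hs => F_eq hp (hn s hs)⟩
  · obtain ⟨p, ⟨x, y, hw, hd⟩, hp⟩ := meets (.inr (.inr (⟨L, hL, hne⟩, K)))
    refine ⟨x, ?_⟩
    rw [word hp hw]
    exact hd

/-! ### Density in the pointwise topologies -/

/-- Density in a topology of pointwise convergence, for any topology `t` on the space itself. -/
theorem dense_of_forall_finset {M : Type*} [MetricSpace M] (t : TopologicalSpace M)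
    (F : Set (M ≃ᵢ M))
    (h : ∀ (g : M ≃ᵢ M) (I : Finset M) (u : M → Set M),
      (∀ i ∈ I, @IsOpen M t (u i) ∧ g i ∈ u i) → ∃ f ∈ F, ∀ i ∈ I, f i ∈ u i) :
    @Dense (M ≃ᵢ M) (TopologicalSpace.induced (fun (g : M ≃ᵢ M) (x : M) => g x)
      (@Pi.topologicalSpace M (fun _ => M) (fun _ => t))) F := by
  let _ : ∀ _ : M, TopologicalSpace M := fun _ => t
  let _ : TopologicalSpace (M ≃ᵢ M) := TopologicalSpace.induced
    (fun (g : M ≃ᵢ M) (x : M) => g x) (@Pi.topologicalSpace M (fun _ => M) (fun _ => t))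
  intro g
  rw [mem_closure_iff]
  rintro _ ⟨V, hV, rfl⟩ hg
  obtain ⟨I, u, hu, hIV⟩ := isOpen_pi_iff.1 hV _ hg
  obtain ⟨f, hf, hfu⟩ := h g I u hu
  exact ⟨f, hIV hfu, hf⟩

/-- An isometry of the completion can be approximated on any finite set of points by a partial
isometry of the rational Urysohn space. -/
theorem IsRationalUrysohn.exists_approx {X : Type*} [MetricSpace X] (hX : IsRationalUrysohn X)
    (g : UniformSpace.Completion X ≃ᵢ UniformSpace.Completion X)
    (I : Finset (UniformSpace.Completion X)) {ε : ℝ} (hε : 0 < ε) :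
    ∃ x y : UniformSpace.Completion X → X,
      (∀ a ∈ I, dist (x a : UniformSpace.Completion X) a < ε ∧
        dist (y a : UniformSpace.Completion X) (g a) < ε) ∧
      ∀ a ∈ I, ∀ b ∈ I, dist (x a) (x b) = dist (y a) (y b) := by
  classical
  have near : ∀ (c : UniformSpace.Completion X) {δ : ℝ}, 0 < δ →
      ∃ z : X, dist (z : UniformSpace.Completion X) c < δ := fun c δ hδ => by
    obtain ⟨z, hz⟩ := (UniformSpace.Completion.denseRange_coe (α := X)).exists_dist_lt c hδ
    exact ⟨z, by rwa [dist_comm]⟩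
  induction I using Finset.induction_on generalizing ε with
  | empty =>
    obtain ⟨z⟩ := hX.nonempty
    exact ⟨fun _ => z, fun _ => z, by simp, by simp⟩
  | insert c I hc ih =>
    obtain ⟨x, y, hxy, hd⟩ := ih (ε := ε / 8) (by positivity)
    obtain ⟨u, hu⟩ := near c (δ := ε / 8) (by positivity)
    obtain ⟨z, hz⟩ := near (g c) (δ := ε / 8) (by positivity)
    obtain ⟨v, hv, hvz⟩ := hX.exists_extension_near (S := I.image fun a => (x a, y a))
      (by
        intro p hp q hq
        obtain ⟨a, ha, rfl⟩ := Finset.mem_image.1 hp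
        obtain ⟨b, hb, rfl⟩ := Finset.mem_image.1 hq
        exact hd a ha b hb) u z (η := ε / 2) (by positivity)
      (by
        intro p hp
        obtain ⟨a, ha, rfl⟩ := Finset.mem_image.1 hp
        have h1 := dist_dist_dist_le (u : UniformSpace.Completion X) (x a) c a
        have h2 := dist_dist_dist_le (y a : UniformSpace.Completion X) z (g a) (g c)
        rw [g.dist_eq, dist_comm a c] at h2
        rw [Real.dist_eq, UniformSpace.Completion.dist_eq, abs_le] at h1 h2
        have := hxy a ha
        rw [abs_le]
        constructor <;> linarith)
    have hv' : ∀ a ∈ I, dist v (y a) = dist u (x a) := fun a ha =>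
      hv _ (Finset.mem_image_of_mem (fun a => (x a, y a)) ha)
    have hvg : dist (v : UniformSpace.Completion X) (g c) < ε := by
      have := dist_triangle (v : UniformSpace.Completion X) z (g c)
      rw [UniformSpace.Completion.dist_eq] at this
      linarith
    have hne : ∀ a ∈ I, a ≠ c := fun a ha h => hc (h ▸ ha)
    refine ⟨Function.update x c u, Function.update y c v, fun a ha => ?_, fun a ha b hb => ?_⟩
    · rcases Finset.mem_insert.1 ha with rfl | ha
      · simp only [Function.update_self]
        exact ⟨by linarith, hvg⟩
      · rw [Function.update_of_ne (hne a ha), Function.update_of_ne (hne a ha)]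
        have := hxy a ha
        constructor <;> linarith
    · rcases Finset.mem_insert.1 ha with rfl | ha' <;> rcases Finset.mem_insert.1 hb with rfl | hb'
      · simp
      · simp [Function.update_of_ne (hne b hb'), hv' b hb']
      · simp [Function.update_of_ne (hne a ha'), dist_comm _ u, dist_comm _ v, hv' a ha']
      · simp [Function.update_of_ne (hne a ha'), Function.update_of_ne (hne b hb'), hd a ha' b hb']

theorem theorem20 {X : Type*} [MetricSpace X] (hX : IsRationalUrysohn X) :
    ∃ F : Subgroup (X ≃ᵢ X),
      Nonempty (F ≃* FreeGroup ℕ) ∧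
      (∀ f ∈ F, (∀ x : X, f x = x) → f = 1) ∧
      ActsHomogeneously F ∧
      @Dense (X ≃ᵢ X) (permTopology X) (F : Set (X ≃ᵢ X)) ∧
      @Dense (X ≃ᵢ X) (weakTopology X) (F : Set (X ≃ᵢ X)) ∧
      @Dense (UniformSpace.Completion X ≃ᵢ UniformSpace.Completion X)
        (weakTopology (UniformSpace.Completion X))
        (F.map (extendIsometry X) :
          Set (UniformSpace.Completion X ≃ᵢ UniformSpace.Completion X)) ∧
      (∀ f ∈ F, f ≠ 1 → f ∉ BAut X) := by
  classical
  obtain ⟨f, hf, hfar⟩ := hX.exists_generic_seq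
  have far : ∀ w : FreeGroup ℕ, w ≠ 1 → FreeGroup.lift f w ∉ BAut X := by
    rintro w hw ⟨k, hk⟩
    obtain ⟨K, hK⟩ := exists_nat_gt k
    obtain ⟨x, hx⟩ := hfar w.toWord FreeGroup.isReduced_toWord
      (mt FreeGroup.toWord_eq_nil_iff.1 hw) K
    rw [FreeGroup.mk_toWord] at hx
    linarith [hk x]
  have inj : Function.Injective (FreeGroup.lift f) := by
    rw [injective_iff_map_eq_one]
    intro w hw
    by_contra h
    exact far w h (hw ▸ (BAut X).one_mem)
  have hom : ∀ S : Finset (X × X), IsPartialIsometry S →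
      ∃ h ∈ (FreeGroup.lift f).range, ∀ s ∈ S, h s.1 = s.2 := fun S hS => by
    obtain ⟨n, hn⟩ := hf S hS
    exact ⟨f n, ⟨FreeGroup.of n, FreeGroup.lift_apply_of⟩, hn⟩
  -- Agreement on finite sets gives density, whatever the topology on `X`.
  have dense : ∀ t : TopologicalSpace X, @Dense (X ≃ᵢ X)
      (TopologicalSpace.induced (fun (g : X ≃ᵢ X) (x : X) => g x)
        (@Pi.topologicalSpace X (fun _ => X) (fun _ => t)))
      ((FreeGroup.lift f).range : Set (X ≃ᵢ X)) := fun t =>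
    dense_of_forall_finset t _ fun g I u hu => by
      obtain ⟨h, hh, e⟩ := hom (I.image fun a => (a, g a)) (by
        intro p hp q hq
        obtain ⟨a, -, rfl⟩ := Finset.mem_image.1 hp
        obtain ⟨b, -, rfl⟩ := Finset.mem_image.1 hq
        exact (g.dist_eq a b).symm)
      refine ⟨h, hh, fun a ha => ?_⟩
      rw [e _ (Finset.mem_image_of_mem (fun a => (a, g a)) ha)]
      exact (hu a ha).2
  refine ⟨(FreeGroup.lift f).range, ⟨(MonoidHom.ofInjective inj).symm⟩,
    fun h _ hx => IsometryEquiv.ext hx, fun A B hA _ φ => ?_, dense _, dense _, ?_, ?_⟩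
  · have := hA.fintype
    obtain ⟨h, hh, e⟩ := hom (Finset.univ.image fun a : A => ((a : X), (φ a : X))) (by
      intro p hp q hq
      obtain ⟨a, -, rfl⟩ := Finset.mem_image.1 hp
      obtain ⟨b, -, rfl⟩ := Finset.mem_image.1 hq
      exact (φ.dist_eq a b).symm)
    exact ⟨h, hh, fun a => e _ (Finset.mem_image_of_mem (fun a : A => ((a : X), (φ a : X)))
      (Finset.mem_univ a))⟩
  · refine dense_of_forall_finset _ _ fun g I u hu => ?_
    have hball : ∀ᶠ ε : ℝ in nhdsWithin 0 (Set.Ioi 0), ∀ a ∈ I,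
        Metric.ball (g a) (ε + ε) ⊆ u a := by
      rw [Filter.eventually_all_finset]
      intro a ha
      obtain ⟨δ, hδ, hsub⟩ := Metric.isOpen_iff.1 (hu a ha).1 _ (hu a ha).2
      filter_upwards [Ioo_mem_nhdsGT (half_pos hδ)] with ε hε
      exact (Metric.ball_subset_ball (by linarith [hε.2])).trans hsub
    obtain ⟨ε, hball, hε⟩ := (hball.and self_mem_nhdsWithin).exists
    obtain ⟨x, y, hxy, hd⟩ := hX.exists_approx g I hε
    obtain ⟨h, hh, e⟩ := hom (I.image fun a => (x a, y a)) (by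
      intro p hp q hq
      obtain ⟨a, ha, rfl⟩ := Finset.mem_image.1 hp
      obtain ⟨b, hb, rfl⟩ := Finset.mem_image.1 hq
      exact hd a ha b hb)
    refine ⟨extendIsometry X h, ⟨h, hh, rfl⟩, fun a ha => hball a ha ?_⟩
    have h1 := dist_triangle_left (extendIsometry X h a) (g a) (extendIsometry X h (x a))
    rw [(extendIsometry X h).dist_eq, extendIsometry_coe,
      e _ (Finset.mem_image_of_mem (fun a => (x a, y a)) ha)] at h1
    exact h1.trans_lt (add_lt_add (hxy a ha).1 (hxy a ha).2)
  · rintro _ ⟨w, rfl⟩ hw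
    exact far w fun h => hw (by rw [h, map_one])
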